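/- For an $N\times k$ array $A$ with entries in a set $S$ of $s$ levels, $t\le k$, $x\in S^t$ and $1\le j_1<\dots<j_t\le k$, let $n(A,x,j)$ be the number of rows $i$ with $A_{i,j_r}=x_r$ for all $r$. $A$ is an orthogonal array (OA) of strength $t$ if $n(A,x,j)=N/s^t$ for all $x,j$. Put $$\mathrm{Tol}_t(A)=\max_{x,j}\,|n(A,x,j)-N/s^t|,\qquad \mathrm{Unb}_{p,t}(A)=\sum_{x,j}|n(A,x,j)-N/s^t|^p\quad(p\in[1,\infty)).$$ **Theorem.** Let $s>2$ be a prime power, $\ell\ge 2$ and $1\le\tilde\kappa\le s-1$ integers. There is an array $A$ with $2s^\ell$ runs (rows), $2\frac{s^\ell-1}{s-1}-1+\tilde\kappa$ factors (columns) and $s$ levels such that: (0) $A$ is an OA of strength one. (1a) The first $2\frac{s^\ell-1}{s-1}-1$ columns of $A$ form an OA of strength two. (1b) Removing from $A$ the first column and any $\tilde\kappa-1$ of the last $\tilde\kappa$ columns leaves an OA of strength two. (2) $\mathrm{Tol}_2(A)=\max\{2,s-2\}\,s^{\ell-2}$. (3) For every real $p\ge 1$, $\mathrm{Unb}_{p,2}(A)=\binom{\tilde\kappa+1}{2}\,2s(s-2)\left((s-2)^{p-1}+2^{p-1}\right)s^{(\ell-2)p}$.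 Moreover, $A$ can be taken to be an instance of the following construction, and every instance of it satisfies (0)–(3). Let $F$ be a field with $s$ elements, let $\Gamma\subset F^{\ell-1}\setminus\{0\}$ contain exactly one spanning vector of each line of $F^{\ell-1}$, and let $\Xi\subset F\setminus\{0\}$ have $\tilde\kappa$ elements. The rows are indexed by two copies (upper and lower) of $F\times F^{\ell-1}\ni(x,y)$. The columns are: first a column $\ast$; then, in any order, columns $L_{a,\gamma}$ and $Q_{\beta,\gamma}$ for $a,\beta\in F$, $\gamma\in\Gamma$; and last, columns $E_\delta$ for $\delta\in\Xi$. The entries in (upper row $(x,y)$; lower row $(x,y)$) are as follows. * For $s$ odd, with $\omega\in F$ a non-square and $\beta_0\in F$: * $\ast$: $(x;\ x)$ * $L_{a,\gamma}$: $\left(ax+\gamma^Ty;\ ax+\gamma^Ty+(1-\tfrac1\omega)\tfrac{a^2}4\right)$ * $Q_{\beta,\gamma}$: $\left((x-\beta)^2+\gamma^Ty;\ \omega(x-\beta)^2+\gamma^Ty\right)$ * $E_\delta$: $\left((x-\beta_0)^2-\delta x;\ \omega(x-\beta_0)^2-\delta x-(1-\tfrac1\omega)\tfrac{\delta^2}4\right)$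 * For $s$ even, with $\zeta\in F$ of absolute trace $\sum_{i=0}^{\log_2 s-1}\zeta^{2^i}=1$: * $\ast$: $(x;\ x)$ * $L_{a,\gamma}$: $\left(ax+\gamma^Ty;\ ax+\gamma^Ty+a^2\zeta\right)$ * $Q_{\beta,\gamma}$: $\left(x^2+\beta x+\gamma^Ty;\ x^2+\beta x+\gamma^Ty+\beta^2\zeta\right)$ * $E_\delta$: $\left(x^2+\delta x;\ x^2+\delta x+\delta^2\zeta\right)$ The rows may be numbered arbitrarily, and the levels may be relabelled by any bijection from $F$ onto an $s$-element set. -/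

import Mathlib

open scoped Matrix

namespace AlmostOrthogonal

section Arrays

variable {R C S : Type*} [Fintype R]

open Classical in
/-- `count A x j` is `n(A,x,j)`: the number of runs (rows) `i` of `A` whose entries in the factors
(columns) `j 0, …, j (t-1)` are `x 0, …, x (t-1)`. -/
noncomputable def count {t : ℕ} (A : Matrix R C S) (x : Fin t → S) (j : Fin t → C) : ℕ :=
  (Finset.univ.filter fun i : R => ∀ r, A i (j r) = x r).card

/-- The set `T_{t,k}` of strictly increasing `t`-tuples of factors. -/
def IncTuple (t : ℕ) (C : Type*) [LinearOrder C] : Type _ := {j : Fin t → C // StrictMono j}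

noncomputable instance (t : ℕ) (C : Type*) [LinearOrder C] [Fintype C] :
    Fintype (IncTuple t C) := by
  classical exact inferInstanceAs (Fintype {j : Fin t → C // StrictMono j})

variable [LinearOrder C] [Fintype C] [Fintype S]

/-- `A` is an orthogonal array of strength `t`: in any `t` factors, every `t`-tuple of levels
occurs exactly `N / s ^ t` times, where `N` is the number of runs and `s` the number of levels. -/
def IsOA (t : ℕ) (A : Matrix R C S) : Prop :=
  t ≤ Fintype.card C ∧ ∀ (x : Fin t → S) (j : IncTuple t C),
    (count A x j.1 : ℝ) = (Fintype.card R : ℝ) / (Fintype.card S : ℝ) ^ t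

/-- The absolute deviation `|n(A,x,j) - N / s ^ t|`. -/
noncomputable def deviation {t : ℕ} (A : Matrix R C S) (x : Fin t → S) (j : IncTuple t C) : ℝ :=
  |(count A x j.1 : ℝ) - (Fintype.card R : ℝ) / (Fintype.card S : ℝ) ^ t|

/-- The tolerance of strength `t`: the maximum of the deviations, a supremum over a finite set. -/
noncomputable def tolerance (t : ℕ) (A : Matrix R C S) : ℝ :=
  ⨆ q : (Fin t → S) × IncTuple t C, deviation A q.1 q.2

/-- The `p`-unbalance of strength `t`. -/
noncomputable def unbalance (p : ℝ) (t : ℕ) (A : Matrix R C S) : ℝ :=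
  ∑ x : Fin t → S, ∑ j : IncTuple t C, deviation A x j ^ p

end Arrays

section Construction

/-- The vector space `F ^ (ℓ - 1)`. -/
abbrev Vec (F : Type) (ℓ : ℕ) : Type := Fin (ℓ - 1) → F

/-- `Γ` consists of nonzero vectors, and every line of `F ^ (ℓ - 1)` is spanned by one and only one
element of `Γ`. -/
def IsLineSystem {F : Type} [Field F] {ℓ : ℕ} (Γ : Set (Vec F ℓ)) : Prop :=
  Set.BijOn (fun v => Submodule.span F {v}) Γ
    {W : Submodule F (Vec F ℓ) | Module.finrank F W = 1}

/-- Names of the columns of the doubled array `(L Q E ; L' Q' E')`: the column `∗`, the linear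
columns `(a, γ)`, the quadratic columns `(β, γ)`, and the extra columns `δ`. -/
inductive Col (F : Type) (ℓ : ℕ) : Type
  | star : Col F ℓ
  | lin (a : F) (γ : Vec F ℓ) : Col F ℓ
  | quad (β : F) (γ : Vec F ℓ) : Col F ℓ
  | extra (δ : F) : Col F ℓ

/-- The columns of the doubled array for the line system `Γ` and the set `Ξ` of extra columns. -/
def colSet {F : Type} {ℓ : ℕ} (Γ : Set (Vec F ℓ)) (Ξ : Set F) : Set (Col F ℓ) :=
  {z | z = .star ∨ (∃ a, ∃ γ ∈ Γ, z = .lin a γ) ∨ (∃ β, ∃ γ ∈ Γ, z = .quad β γ) ∨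
    ∃ δ ∈ Ξ, z = .extra δ}

/-- Rows: pairs `(x, y) ∈ F × F ^ (ℓ - 1)`, once in the upper half (`Sum.inl`) and once in the
lower half (`Sum.inr`). -/
abbrev Row (F : Type) (ℓ : ℕ) : Type := (F × Vec F ℓ) ⊕ (F × Vec F ℓ)

/-- Entries of the doubled array in odd characteristic; `ω` is to be a non-square. -/
def oddEntry {F : Type} [Field F] {ℓ : ℕ} (ω β₀ : F) : Row F ℓ → Col F ℓ → F
  | .inl (x, _), .star => x
  | .inr (x, _), .star => x
  | .inl (x, y), .lin a γ => a * x + γ ⬝ᵥ y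
  | .inr (x, y), .lin a γ => a * x + γ ⬝ᵥ y + (1 - 1 / ω) * (a ^ 2 / 4)
  | .inl (x, y), .quad β γ => (x - β) ^ 2 + γ ⬝ᵥ y
  | .inr (x, y), .quad β γ => ω * (x - β) ^ 2 + γ ⬝ᵥ y
  | .inl (x, _), .extra a => (x - β₀) ^ 2 - a * x
  | .inr (x, _), .extra a => ω * (x - β₀) ^ 2 - a * x - (1 - 1 / ω) * (a ^ 2 / 4)

/-- Entries of the doubled array in characteristic two; `ζ` is to have absolute trace one. -/
def evenEntry {F : Type} [Field F] {ℓ : ℕ} (ζ : F) : Row F ℓ → Col F ℓ → F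
  | .inl (x, _), .star => x
  | .inr (x, _), .star => x
  | .inl (x, y), .lin a γ => a * x + γ ⬝ᵥ y
  | .inr (x, y), .lin a γ => a * x + γ ⬝ᵥ y + a ^ 2 * ζ
  | .inl (x, y), .quad β γ => x ^ 2 + β * x + γ ⬝ᵥ y
  | .inr (x, y), .quad β γ => x ^ 2 + β * x + γ ⬝ᵥ y + β ^ 2 * ζ
  | .inl (x, _), .extra δ => x ^ 2 + δ * x
  | .inr (x, _), .extra δ => x ^ 2 + δ * x + δ ^ 2 * ζ

/-- The number `2 (s ^ ℓ - 1) / (s - 1) - 1` of columns other than the extra ones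
(the division is exact). -/
def baseCols (s ℓ : ℕ) : ℕ := 2 * ((s ^ ℓ - 1) / (s - 1)) - 1

/-- Arrays with `2 s ^ ℓ` runs, `2 (s ^ ℓ - 1) / (s - 1) - 1 + κ` factors and `s` levels. -/
abbrev AKArray (s ℓ κ : ℕ) : Type :=
  Matrix (Fin (2 * s ^ ℓ)) (Fin (baseCols s ℓ + κ)) (Fin s)

/-- `A` is an instance of the doubled Addelman-Kempthorne construction over a field with `s`
elements, after numbering the levels (by `σ`), the rows (by `r`) and the columns (by `c`), where
the column `∗` comes first and the `κ` extra columns come last. -/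
def IsDoubledAK (s ℓ κ : ℕ) (A : AKArray s ℓ κ) : Prop :=
  ∃ (F : Type) (_ : Field F) (σ : Fin s ≃ F) (r : Fin (2 * s ^ ℓ) ≃ Row F ℓ)
    (Γ : Set (Vec F ℓ)) (Ξ : Set F) (c : Fin (baseCols s ℓ + κ) → Col F ℓ),
    IsLineSystem Γ ∧ (0 : F) ∉ Ξ ∧ Ξ.ncard = κ ∧
    Set.BijOn c Set.univ (colSet Γ Ξ) ∧
    (∀ j, j.val = 0 → c j = .star) ∧
    (∀ j, baseCols s ℓ ≤ j.val → ∃ δ ∈ Ξ, c j = .extra δ) ∧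
    ((Odd s ∧ ∃ ω β₀ : F, ¬ IsSquare ω ∧ ∀ i j, σ (A i j) = oddEntry ω β₀ (r i) (c j)) ∨
     (Even s ∧ ∃ ζ : F, ∑ i ∈ Finset.range (Nat.log 2 s), ζ ^ 2 ^ i = 1 ∧
        ∀ i j, σ (A i j) = evenEntry ζ (r i) (c j)))

/-- The properties claimed of the array. -/
structure AKProperties (s ℓ κ : ℕ) (A : AKArray s ℓ κ) : Prop where
  /-- `A` is an orthogonal array of strength one. -/
  strength_one : IsOA 1 A
  /-- The columns other than the last `κ` form an orthogonal array of strength two. -/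
  first_cols : IsOA 2 (A.submatrix id (Fin.castAdd κ : Fin (baseCols s ℓ) → _))
  /-- Removing the first column and any `κ - 1` of the last `κ` columns leaves an orthogonal array
  of strength two. -/
  removed_cols : ∀ D : Finset (Fin (baseCols s ℓ + κ)),
    (∀ j ∈ D, baseCols s ℓ ≤ j.val) → D.card = κ - 1 →
      IsOA 2 (A.submatrix id
        (Subtype.val : {j : Fin (baseCols s ℓ + κ) // j.val ≠ 0 ∧ j ∉ D} → _))
  tolerance_eq : tolerance 2 A = max 2 ((s : ℝ) - 2) * (s : ℝ) ^ (ℓ - 2)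
  unbalance_eq : ∀ p : ℝ, 1 ≤ p →
    unbalance p 2 A = ((κ + 1).choose 2 : ℝ) * (2 * s * ((s : ℝ) - 2)) *
      (((s : ℝ) - 2) ^ (p - 1) + (2 : ℝ) ^ (p - 1)) * (s : ℝ) ^ (((ℓ : ℝ) - 2) * p)

end Construction

end AlmostOrthogonal

namespace AlmostOrthogonal

open Finset

set_option linter.unusedSectionVars false

/-! ### Balanced functions and the split of an entry into a base part and a linear part -/

section

variable {F : Type} [Field F] [Fintype F] [DecidableEq F] {ℓ : ℕ}

/-! Every entry is a base value depending only on `p = (half, x)`, one of `2s` points, plus `dir z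
⬝ᵥ y`. Counting rows with prescribed entries in two columns is thus a sum over `p` of numbers of
solutions `y` of two linear equations.

Independent directions give the same number of solutions for every `p`. If just one direction
vanishes, the count is uniform provided the base of that column takes each level twice; if the
directions are equal and nonzero, provided the difference of the bases does. Such differences are
affine and bijective on each half, or quadratic. In the quadratic case the lower half has the roots
that the upper half lacks: its discriminant is multiplied by the non-square `ω`, or its right-hand
side is shifted out of the image of the additive map `x ^ 2 + b * x`.

Only `∗` and the `κ` extra columns have direction zero. Two of these embed the `2s` points into `F ×
F`, so `2s` level pairs occur `s ^ (ℓ - 1)` times each and the others never. Against the mean `2 s ^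
(ℓ - 2)`, this gives both deviations, and `κ + 1` choose `2` pairs of columns contribute. -/

/-- Every level is taken exactly twice on the two copies of `F` together. -/
def Balanced (f : F ⊕ F → F) : Prop := ∀ u, #{p | f p = u} = 2

theorem card_filter_sum (P : F ⊕ F → Prop) [DecidablePred P] :
    #{p | P p} = #{x : F | P (.inl x)} + #{x : F | P (.inr x)} := by
  rw [card_filter, card_filter, card_filter, Fintype.sum_sum_type]

theorem balanced_iff {f : F ⊕ F → F} :
    Balanced f ↔ ∀ u, #{x | f (.inl x) = u} + #{x | f (.inr x) = u} = 2 := by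
  simp only [Balanced, card_filter_sum]

theorem card_filter_eq_one_of_bijective {g : F → F} (hg : Function.Bijective g) (u : F) :
    #{x | g x = u} = 1 := by
  obtain ⟨x, hx, h⟩ := hg.existsUnique u
  exact card_eq_one.2 ⟨x, by ext y; simpa using ⟨h y, fun e => e ▸ hx⟩⟩

theorem balanced_of_injective {f : F ⊕ F → F} (hl : Function.Injective fun x => f (.inl x))
    (hr : Function.Injective fun x => f (.inr x)) : Balanced f := by
  intro u
  rw [card_filter_sum, card_filter_eq_one_of_bijective (Finite.injective_iff_bijective.1 hl),
    card_filter_eq_one_of_bijective (Finite.injective_iff_bijective.1 hr)]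

theorem Balanced.neg {f : F ⊕ F → F} (h : Balanced f) : Balanced fun p => -f p := by
  intro u
  simpa [neg_eq_iff_eq_neg] using h (-u)

theorem injective_of_halves {β : Type*} {g : F ⊕ F → β}
    (hl : Function.Injective fun x => g (.inl x)) (hr : Function.Injective fun x => g (.inr x))
    (hlr : ∀ x y, g (.inl x) ≠ g (.inr y)) : Function.Injective g := by
  rintro (x | x) (y | y) h
  · exact congrArg _ (hl h)
  · exact (hlr _ _ h).elim
  · exact (hlr _ _ h.symm).elim
  · exact congrArg _ (hr h)

/-- The part of an entry that does not depend on `y`. -/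
def base (e : Row F ℓ → Col F ℓ → F) (p : F ⊕ F) (z : Col F ℓ) : F :=
  e (p.map (·, 0) (·, 0)) z

/-- The direction in which a column depends on `y`. -/
def dir : Col F ℓ → Vec F ℓ
  | .star => 0
  | .lin _ γ => γ
  | .quad _ γ => γ
  | .extra _ => 0

/-- The pair `(half, x)` of a row. -/
def rowBase (i : Row F ℓ) : F ⊕ F := i.map Prod.fst Prod.fst

/-- The component `y` of a row. -/
def rowVec (i : Row F ℓ) : Vec F ℓ := i.elim Prod.snd Prod.snd

/-- The facts about an entry function that make the doubled array almost orthogonal. -/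
structure IsDoubling (e : Row F ℓ → Col F ℓ → F) : Prop where
  split : ∀ i z, e i z = base e (rowBase i) z + dir z ⬝ᵥ rowVec i
  star : Balanced fun p => base e p .star
  extra : ∀ δ ≠ 0, Balanced fun p => base e p (.extra δ)
  lin_lin : ∀ a a' γ, a ≠ a' → Balanced fun p => base e p (.lin a γ) - base e p (.lin a' γ)
  lin_quad : ∀ a β γ, Balanced fun p => base e p (.lin a γ) - base e p (.quad β γ)
  quad_quad : ∀ β β' γ, β ≠ β' →
    Balanced fun p => base e p (.quad β γ) - base e p (.quad β' γ)
  star_extra : ∀ δ ≠ 0, Function.Injective fun p => (base e p .star, base e p (.extra δ))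
  extra_extra : ∀ δ ≠ 0, ∀ δ' ≠ 0, δ ≠ δ' →
    Function.Injective fun p => (base e p (.extra δ), base e p (.extra δ'))

/-! ### Odd characteristic -/

/-- An element has `χ + 1` square roots, `χ` being the quadratic character, and `χ` changes sign
under multiplication by `ω`. -/
theorem card_sqrt_add_card_sqrt (h2 : ringChar F ≠ 2) {ω : F} (hω : ¬ IsSquare ω) (e : F) :
    #{x : F | x ^ 2 = e} + #{x : F | x ^ 2 = ω * e} = 2 := by
  have h := quadraticChar_card_sqrts h2
  have h1 := h e
  have h3 := h (ω * e)
  rw [map_mul, quadraticChar_neg_one_iff_not_isSquare.2 hω] at h3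
  simp only [Set.toFinset_ofPred] at h1 h3
  zify
  rw [h1, h3]
  ring

theorem card_filter_affine {c : F} (hc : c ≠ 0) (d : F) (P : F → Prop) [DecidablePred P] :
    #{x : F | P (c * x - d)} = #{x : F | P x} := by
  refine card_bijective (fun x => c * x - d) (Finite.injective_iff_bijective.1 ?_) (by simp)
  intro x y h
  simpa [hc] using h

/-- Multiplying by `-4`, respectively `-4ω`, and completing the square gives `X ^ 2 = D` and `X ^ 2
= ω * D` with the same `D`. The constant `(1 - 1 / ω) * (a ^ 2 / 4)` is there to make the two
discriminants proportional. -/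
theorem card_quadratic_add_card_quadratic (h2 : ringChar F ≠ 2) {ω : F} (hω : ¬ IsSquare ω)
    (a β d : F) :
    #{x : F | a * x - (x - β) ^ 2 = d} +
      #{x : F | a * x + (1 - 1 / ω) * (a ^ 2 / 4) - ω * (x - β) ^ 2 = d} = 2 := by
  have two : (2 : F) ≠ 0 := Ring.two_ne_zero h2
  have hω0 : ω ≠ 0 := by rintro rfl; exact hω (IsSquare.zero)
  have four : (4 : F) ≠ 0 := by
    have : (4 : F) = 2 * 2 := by norm_num
    rw [this]; exact mul_ne_zero two two
  refine Eq.trans ?_ (card_sqrt_add_card_sqrt h2 hω (a ^ 2 - 4 * (d - a * β)))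
  rw [← card_filter_affine two (2 * β + a) (fun x => x ^ 2 = a ^ 2 - 4 * (d - a * β)),
    ← card_filter_affine (mul_ne_zero two hω0) (2 * ω * β + a)
      (fun x => x ^ 2 = ω * (a ^ 2 - 4 * (d - a * β)))]
  congr 3 <;> ext x
  · constructor
    · intro h; linear_combination (-4) * h
    · intro h
      apply mul_left_cancel₀ four
      linear_combination (-1) * h
  · have key : ω * (a * x + (1 - 1 / ω) * (a ^ 2 / 4) - ω * (x - β) ^ 2) * 4 =
        ω * a * x * 4 + (ω - 1) * a ^ 2 - 4 * ω ^ 2 * (x - β) ^ 2 := by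
      field_simp
    constructor
    · intro h; linear_combination (-4 * ω) * h + key
    · intro h
      apply mul_left_cancel₀ (mul_ne_zero hω0 four)
      linear_combination (-1) * h + key

theorem oddEntry_isDoubling (h2 : ringChar F ≠ 2) {ω : F} (hω : ¬ IsSquare ω) (β₀ : F) :
    IsDoubling (oddEntry (ℓ := ℓ) ω β₀) := by
  have two : (2 : F) ≠ 0 := Ring.two_ne_zero h2
  have hω0 : ω ≠ 0 := by rintro rfl; exact hω (IsSquare.zero)
  have hω1 : ω - 1 ≠ 0 := by
    intro h; exact hω (by rw [sub_eq_zero.1 h]; exact IsSquare.one)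
  have four : (4 : F) ≠ 0 := by
    have : (4 : F) = 2 * 2 := by norm_num
    rw [this]; exact mul_ne_zero two two
  have nonsq : ∀ X Y : F, ω * X ^ 2 = Y ^ 2 → Y = 0 := by
    intro X Y h
    by_contra hY
    have hX : X ≠ 0 := by
      rintro rfl
      exact hY (by simpa using h.symm)
    exact hω ⟨Y / X, by field_simp; linear_combination h⟩
  have lq : ∀ a β γ, Balanced fun p => base (oddEntry (ℓ := ℓ) ω β₀) p (.lin a γ) -
      base (oddEntry (ℓ := ℓ) ω β₀) p (.quad β γ) := by
    intro a β γ
    rw [balanced_iff]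
    intro d
    simpa [base, oddEntry] using card_quadratic_add_card_quadratic h2 hω a β d
  have quarter : ∀ t : F, ω * ((1 - 1 / ω) * (t ^ 2 / 4)) * 4 = (ω - 1) * t ^ 2 := by
    intro t
    field_simp
  refine ⟨?_, ?_, ?_, ?_, lq, ?_, ?_, ?_⟩
  · rintro (⟨x, y⟩ | ⟨x, y⟩) (_ | _ | _ | _) <;>
      simp [base, oddEntry, dir, rowBase, rowVec] <;> ring
  · exact balanced_of_injective (fun x y h => h) (fun x y h => h)
  · intro δ hδ
    -- The extra column is the base of a quadratic column minus that of a linear one, with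
    -- parameters `β₀` and `δ`; the direction is immaterial.
    have h := (lq δ β₀ 0).neg
    convert h using 2 with p
    rcases p with x | x <;> simp [base, oddEntry] <;> ring
  · intro a a' γ h
    have h' := sub_ne_zero.2 h
    refine balanced_of_injective (fun x y e => ?_) (fun x y e => ?_) <;>
      simp only [base, oddEntry, Sum.map_inl, Sum.map_inr] at e <;>
      exact mul_left_cancel₀ h' (by linear_combination e)
  · intro β β' γ h
    have h' := sub_ne_zero.2 h
    refine balanced_of_injective (fun x y e => ?_) (fun x y e => ?_) <;>
      simp only [base, oddEntry, Sum.map_inl, Sum.map_inr] at e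
    · refine mul_left_cancel₀ (mul_ne_zero two h') ?_
      linear_combination (-1) * e
    · refine mul_left_cancel₀ (mul_ne_zero hω0 (mul_ne_zero two h')) ?_
      linear_combination (-1) * e
  · intro δ hδ
    refine injective_of_halves (fun x y e => (Prod.ext_iff.1 e).1)
      (fun x y e => (Prod.ext_iff.1 e).1) fun x y e => ?_
    simp only [base, oddEntry, Sum.map_inl, Sum.map_inr, Prod.mk.injEq] at e
    obtain ⟨rfl, e⟩ := e
    -- A collision between the halves would give `ω * (2 * (x - β₀)) ^ 2 = δ ^ 2`.
    refine hδ (nonsq (2 * (x - β₀)) δ (mul_left_cancel₀ hω1 ?_))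
    linear_combination (-4 * ω) * e + quarter δ
  · intro δ _ δ' _ h
    have h' := sub_ne_zero.2 h
    refine injective_of_halves (fun x y e => ?_) (fun x y e => ?_) fun x y e => ?_ <;>
      simp only [base, oddEntry, Sum.map_inl, Sum.map_inr, Prod.mk.injEq] at e <;>
      obtain ⟨e, e'⟩ := e
    · refine mul_left_cancel₀ h' ?_
      linear_combination e' - e
    · refine mul_left_cancel₀ h' ?_
      linear_combination e' - e
    -- Subtracting the two equations cancels the quadratic terms. Eliminating `y` then writes `(δ -
    -- δ') ^ 2` as `ω` times a square.
    · have hy : 4 * ω * y = 4 * ω * x - (ω - 1) * (δ + δ') := by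
        refine mul_left_cancel₀ h' ?_
        linear_combination (-4 * ω) * (e' - e) + quarter δ' - quarter δ
      refine h' (nonsq (4 * (x - β₀) - (δ + δ')) _ (mul_left_cancel₀ hω1 ?_))
      linear_combination (-16 * ω) * e + 4 * quarter δ -
        (4 * ω * y + 4 * ω * x - (ω - 1) * (δ + δ') - 8 * ω * β₀ - 4 * δ) * hy

/-! ### Characteristic two -/

/-- For `b ≠ 0` the additive map `x ^ 2 + b * x` has kernel `{0, b}`, so its image has index two. As
`b ^ 2 * ζ` lies outside the image, exactly one of `d` and `d + b ^ 2 * ζ` lies in it, and that one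
has two preimages. For `b = 0` both equations have one root, by injectivity of Frobenius. -/
theorem card_artinSchreier_add_card_artinSchreier [CharP F 2] {ζ : F}
    (hζ : ∀ z : F, z ^ 2 + z ≠ ζ) (b d : F) :
    #{x : F | x ^ 2 + b * x = d} + #{x : F | x ^ 2 + b * x + b ^ 2 * ζ = d} = 2 := by
  by_cases hb : b = 0
  · have : Function.Injective fun x : F => x ^ 2 := by
      intro x y h
      exact frobenius_inj F 2 h
    simp [hb, card_filter_eq_one_of_bijective (Finite.injective_iff_bijective.1 this)]
  let ψ : F →+ F :=
    { toFun := fun x => x ^ 2 + b * x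
      map_zero' := by simp
      map_add' := fun x y => by rw [CharTwo.add_sq]; ring }
  have hψ : ∀ x, ψ x = x ^ 2 + b * x := fun _ => rfl
  have hker : #{x : F | ψ x = 0} = 2 := by
    rw [card_eq_two]
    refine ⟨0, b, Ne.symm hb, ?_⟩
    ext x
    have : x ^ 2 + b * x = x * (x - b) := by rw [CharTwo.sub_eq_add]; ring
    simp [hψ, this, sub_eq_zero]
  have hindex : ψ.range.index = 2 := by
    have h1 := ψ.ker.card_mul_index
    have h2 := ψ.range.card_mul_index
    have h3 : Nat.card ψ.ker = 2 := by
      rw [← hker, Nat.card_eq_fintype_card, ← Fintype.card_coe]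
      exact Fintype.card_congr (Equiv.subtypeEquivRight fun x => by simp [AddMonoidHom.mem_ker])
    rw [AddSubgroup.index_ker, h3] at h1
    have h4 : 0 < Nat.card ψ.range := Nat.card_pos
    exact Nat.eq_of_mul_eq_mul_left h4 (by rw [h2, ← h1, mul_comm])
  have hfib : ∀ d, #{x : F | ψ x = d} = if d ∈ ψ.range then 2 else 0 := by
    intro d
    split_ifs with h
    · rw [← hker]
      exact AddMonoidHom.card_fiber_eq_of_mem_range ψ h ⟨0, map_zero ψ⟩
    · rw [card_eq_zero, filter_eq_empty_iff]
      exact fun x _ e => h ⟨x, e⟩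
  have hnot : b ^ 2 * ζ ∉ ψ.range := by
    rintro ⟨x, hx⟩
    refine hζ (x / b) ?_
    rw [hψ] at hx
    field_simp
    linear_combination hx
  have hr : ∀ x, (x ^ 2 + b * x + b ^ 2 * ζ = d) ↔ ψ x = d + b ^ 2 * ζ := by
    intro x
    rw [hψ, ← CharTwo.sub_eq_add d, eq_sub_iff_add_eq]
  simp only [hr]
  simp only [← hψ]
  rw [hfib, hfib]
  have := AddSubgroup.add_mem_iff_of_index_two hindex (a := d) (b := b ^ 2 * ζ)
  split_ifs <;> tauto

/-- The trace sum of `z ^ 2 + z` telescopes to `z ^ 2 ^ n - z = 0`. -/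
theorem sq_add_self_ne [CharP F 2] {n : ℕ} (hn : Fintype.card F = 2 ^ n) {ζ : F}
    (hζ : ∑ i ∈ range n, ζ ^ 2 ^ i = 1) (z : F) : z ^ 2 + z ≠ ζ := by
  rintro rfl
  have : ∀ m, ∑ i ∈ range m, (z ^ 2 + z) ^ 2 ^ i = z ^ 2 ^ m - z := by
    intro m
    induction m with
    | zero => simp
    | succ m ih =>
      rw [sum_range_succ, ih, add_pow_char_pow, ← pow_mul, ← pow_succ']
      linear_combination CharTwo.add_self_eq_zero (z ^ 2 ^ m)
  rw [this, ← hn, FiniteField.pow_card, sub_self] at hζ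
  exact zero_ne_one hζ

theorem evenEntry_isDoubling [CharP F 2] {ζ : F} (hζ : ∀ z : F, z ^ 2 + z ≠ ζ) :
    IsDoubling (evenEntry (ℓ := ℓ) ζ) := by
  have hζ0 : ζ ≠ 0 := fun h => hζ 0 (by simp [h])
  have t2 : (2 : F) = 0 := CharTwo.two_eq_zero
  have lq : ∀ a β γ, Balanced fun p => base (evenEntry (ℓ := ℓ) ζ) p (.lin a γ) -
      base (evenEntry (ℓ := ℓ) ζ) p (.quad β γ) := by
    intro a β γ
    rw [balanced_iff]
    intro d
    -- In characteristic two the constants combine as `a ^ 2 + β ^ 2 = (a + β) ^ 2`.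
    rw [← card_artinSchreier_add_card_artinSchreier hζ (a + β) d]
    congr 3 <;> ext x <;> simp only [base, evenEntry, Sum.map_inl, Sum.map_inr, dotProduct_zero]
    · rw [show a * x + 0 - (x ^ 2 + β * x + 0) = x ^ 2 + (a + β) * x by
        linear_combination -(x ^ 2 + β * x) * t2]
    · rw [show a * x + 0 + a ^ 2 * ζ - (x ^ 2 + β * x + 0 + β ^ 2 * ζ) =
          x ^ 2 + (a + β) * x + (a + β) ^ 2 * ζ by
        linear_combination -(x ^ 2 + β * x + β ^ 2 * ζ + a * β * ζ) * t2]
  refine ⟨?_, ?_, ?_, ?_, lq, ?_, ?_, ?_⟩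
  · rintro (⟨x, y⟩ | ⟨x, y⟩) (_ | _ | _ | _) <;>
      simp [base, evenEntry, dir, rowBase, rowVec] <;> ring
  · exact balanced_of_injective (fun x y h => h) (fun x y h => h)
  · intro δ hδ
    have h := (lq 0 δ 0).neg
    convert h using 2 with p
    rcases p with x | x <;> simp [base, evenEntry]
  · intro a a' γ h
    have h' := sub_ne_zero.2 h
    refine balanced_of_injective (fun x y e => ?_) (fun x y e => ?_) <;>
      simp only [base, evenEntry, Sum.map_inl, Sum.map_inr] at e <;>
      exact mul_left_cancel₀ h' (by linear_combination e)
  · intro β β' γ h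
    have h' := sub_ne_zero.2 h
    refine balanced_of_injective (fun x y e => ?_) (fun x y e => ?_) <;>
      simp only [base, evenEntry, Sum.map_inl, Sum.map_inr] at e <;>
      exact mul_left_cancel₀ h' (by linear_combination e)
  · intro δ hδ
    refine injective_of_halves (fun x y e => (Prod.ext_iff.1 e).1)
      (fun x y e => (Prod.ext_iff.1 e).1) fun x y e => ?_
    simp only [base, evenEntry, Sum.map_inl, Sum.map_inr, Prod.mk.injEq] at e
    obtain ⟨rfl, e⟩ := e
    simp [hδ, hζ0] at e
  · intro δ _ δ' _ h
    have h' := sub_ne_zero.2 h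
    refine injective_of_halves (fun x y e => ?_) (fun x y e => ?_) fun x y e => ?_ <;>
      simp only [base, evenEntry, Sum.map_inl, Sum.map_inr, Prod.mk.injEq] at e <;>
      obtain ⟨e, e'⟩ := e
    · refine mul_left_cancel₀ h' ?_
      linear_combination e - e'
    · refine mul_left_cancel₀ h' ?_
      linear_combination e - e'
    -- Subtracting the equations leaves this linear relation. Substituting it back gives `(δ + δ') ^
    -- 2 * ζ = δ * δ'`, whence `z = δ / (δ + δ')` solves `z ^ 2 + z = ζ`.
    · have hx : x = y + (δ + δ') * ζ := by
        refine mul_left_cancel₀ h' ?_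
        linear_combination e - e'
      have hΔ : δ + δ' ≠ 0 := by rwa [← CharTwo.sub_eq_add]
      subst hx
      have hm : (δ + δ') ^ 2 * ζ = δ * δ' := by
        refine mul_left_cancel₀ hζ0 ?_
        linear_combination e - (y * (δ + δ') * ζ + δ * δ' * ζ) * t2
      refine hζ (δ / (δ + δ')) ?_
      field_simp
      linear_combination δ ^ 2 * t2 - hm

/-! ### Solutions of linear equations -/

theorem card_mul_card_fiber {V W : Type*} [AddCommGroup V] [Fintype V] [AddCommGroup W] [Fintype W]
    [DecidableEq W] (φ : V →+ W) (hφ : Function.Surjective φ) (w : W) :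
    Fintype.card W * #{y | φ y = w} = Fintype.card V := by
  have h := card_eq_sum_card_fiberwise (f := φ) (s := univ) (t := univ) (by simp)
  rw [card_univ] at h
  rw [h, sum_congr rfl fun v _ => AddMonoidHom.card_fiber_eq_of_mem_range φ (hφ v) (hφ w)]
  simp

theorem exists_dotProduct_ne_zero {γ : Vec F ℓ} (hγ : γ ≠ 0) : ∃ y, γ ⬝ᵥ y ≠ 0 := by
  by_contra! h
  exact hγ (dotProduct_eq_zero γ h)

theorem card_dotProduct_eq {γ : Vec F ℓ} (hγ : γ ≠ 0) (w : F) :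
    Fintype.card F * #{y : Vec F ℓ | γ ⬝ᵥ y = w} = Fintype.card (Vec F ℓ) := by
  refine card_mul_card_fiber (AddMonoidHom.mk' (γ ⬝ᵥ ·) (dotProduct_add γ)) (fun w => ?_) w
  obtain ⟨y, hy⟩ := exists_dotProduct_ne_zero hγ
  exact ⟨(w / (γ ⬝ᵥ y)) • y, by simp [hy]⟩

theorem card_dotProduct_eq_and {γ γ' : Vec F ℓ} (hγ : γ ≠ 0) (hγ' : ∀ c : F, γ' ≠ c • γ)
    (w w' : F) :
    Fintype.card F ^ 2 * #{y : Vec F ℓ | γ ⬝ᵥ y = w ∧ γ' ⬝ᵥ y = w'} =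
      Fintype.card (Vec F ℓ) := by
  have h := card_mul_card_fiber
    (AddMonoidHom.mk' (fun y : Vec F ℓ => (γ ⬝ᵥ y, γ' ⬝ᵥ y))
      (fun y z => by simp [dotProduct_add])) (fun w => ?_) (w, w')
  · simpa [sq] using h
  obtain ⟨y, hy⟩ := exists_dotProduct_ne_zero hγ
  -- Otherwise `γ'` would vanish on the kernel of `γ` and be a multiple of it. With `y` and `z` the
  -- two equations are solved in triangular form.
  obtain ⟨z, hz, hz'⟩ : ∃ z, γ ⬝ᵥ z = 0 ∧ γ' ⬝ᵥ z ≠ 0 := by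
    by_contra! hall
    refine hγ' (γ' ⬝ᵥ y / (γ ⬝ᵥ y)) (dotProduct_eq _ _ fun z => ?_)
    have := hall (z - (γ ⬝ᵥ z / (γ ⬝ᵥ y)) • y) (by simp [dotProduct_sub, hy])
    simp only [dotProduct_sub, dotProduct_smul, smul_eq_mul, sub_eq_zero] at this
    rw [this, smul_dotProduct, smul_eq_mul]
    ring
  refine ⟨(w.1 / (γ ⬝ᵥ y)) • y +
    ((w.2 - w.1 / (γ ⬝ᵥ y) * (γ' ⬝ᵥ y)) / (γ' ⬝ᵥ z)) • z, Prod.ext ?_ ?_⟩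
  · simp [dotProduct_add, hz, hy]
  · simp [dotProduct_add, hz']

/-! ### Counting rows -/

theorem card_filter_row (P : F ⊕ F → Vec F ℓ → Prop) [∀ p, DecidablePred (P p)] :
    #{i : Row F ℓ | P (rowBase i) (rowVec i)} = ∑ p, #{y | P p y} := by
  simp_rw [card_filter]
  rw [Fintype.sum_sum_type, Fintype.sum_sum_type, Fintype.sum_prod_type, Fintype.sum_prod_type]
  rfl

theorem card_row : Fintype.card (Row F ℓ) = 2 * (Fintype.card F * Fintype.card (Vec F ℓ)) := by
  rw [Fintype.card_sum, Fintype.card_prod, two_mul]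

/-- The number of rows with given entries in two columns. -/
def pairCount (e : Row F ℓ → Col F ℓ → F) (z z' : Col F ℓ) (u v : F) : ℕ :=
  #{i | e i z = u ∧ e i z' = v}

theorem pairCount_comm (e : Row F ℓ → Col F ℓ → F) (z z' : Col F ℓ) (u v : F) :
    pairCount e z z' u v = pairCount e z' z v u := by
  simp only [pairCount, and_comm]

namespace IsDoubling

variable {e : Row F ℓ → Col F ℓ → F} (he : IsDoubling e)
include he

theorem pairCount_eq_sum (z z' : Col F ℓ) (u v : F) : pairCount e z z' u v =
    ∑ p, #{y : Vec F ℓ | base e p z + dir z ⬝ᵥ y = u ∧ base e p z' + dir z' ⬝ᵥ y = v} := by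
  rw [← card_filter_row fun p y => base e p z + dir z ⬝ᵥ y = u ∧ base e p z' + dir z' ⬝ᵥ y = v]
  simp only [pairCount, ← he.split]

theorem card_level_of_dir_ne_zero {z : Col F ℓ} (hz : dir z ≠ 0) (u : F) :
    Fintype.card F * #{i | e i z = u} = Fintype.card (Row F ℓ) := by
  simp only [he.split _ z]
  rw [card_filter_row fun p y => base e p z + dir z ⬝ᵥ y = u, mul_sum]
  simp only [← eq_sub_iff_add_eq', card_dotProduct_eq hz]
  rw [sum_const, card_univ, Fintype.card_sum, card_row, smul_eq_mul]
  ring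

theorem card_level_of_dir_eq_zero {z : Col F ℓ} (hz : dir z = 0)
    (hb : Balanced fun p => base e p z) (u : F) :
    Fintype.card F * #{i | e i z = u} = Fintype.card (Row F ℓ) := by
  simp only [he.split _ z]
  rw [card_filter_row fun p y => base e p z + dir z ⬝ᵥ y = u]
  simp only [hz, zero_dotProduct, add_zero, filter_const, apply_ite card, card_univ, card_empty]
  rw [← sum_filter, sum_const, hb, card_row, smul_eq_mul]
  ring

theorem pairCount_of_independent {z z' : Col F ℓ} (hz : dir z ≠ 0)
    (hz' : ∀ c : F, dir z' ≠ c • dir z) (u v : F) :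
    Fintype.card F ^ 2 * pairCount e z z' u v = Fintype.card (Row F ℓ) := by
  rw [he.pairCount_eq_sum, mul_sum]
  simp only [← eq_sub_iff_add_eq', card_dotProduct_eq_and hz hz']
  rw [sum_const, card_univ, Fintype.card_sum, card_row, smul_eq_mul]
  ring

/-- The first equation does not involve `y` and selects exactly two base points; the second then
cuts out a hyperplane for each. -/
theorem pairCount_of_dir_eq_zero_left {z z' : Col F ℓ} (hz : dir z = 0) (hz' : dir z' ≠ 0)
    (hb : Balanced fun p => base e p z) (u v : F) :
    Fintype.card F ^ 2 * pairCount e z z' u v = Fintype.card (Row F ℓ) := by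
  have key : ∀ p, Fintype.card F *
      #{y : Vec F ℓ | base e p z + dir z ⬝ᵥ y = u ∧ base e p z' + dir z' ⬝ᵥ y = v} =
        if base e p z = u then Fintype.card (Vec F ℓ) else 0 := by
    intro p
    simp only [hz, zero_dotProduct, add_zero]
    split_ifs with h
    · simp only [h, true_and, ← eq_sub_iff_add_eq', card_dotProduct_eq hz']
    · simp [h]
  rw [he.pairCount_eq_sum, sq, mul_assoc, mul_sum]
  simp only [key]
  rw [← sum_filter, sum_const, hb, card_row, smul_eq_mul]
  ring

/-- The two equations in `y` are parallel, hence compatible only when the bases differ by `u - v`.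
This happens at two base points, where the equations coincide. -/
theorem pairCount_of_dir_eq {z z' : Col F ℓ} (hz : dir z ≠ 0) (hzz' : dir z' = dir z)
    (hb : Balanced fun p => base e p z - base e p z') (u v : F) :
    Fintype.card F ^ 2 * pairCount e z z' u v = Fintype.card (Row F ℓ) := by
  have key : ∀ p, Fintype.card F *
      #{y : Vec F ℓ | base e p z + dir z ⬝ᵥ y = u ∧ base e p z' + dir z' ⬝ᵥ y = v} =
        if base e p z - base e p z' = u - v then Fintype.card (Vec F ℓ) else 0 := by
    intro p
    simp only [← eq_sub_iff_add_eq', hzz']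
    split_ifs with h
    · have : v - base e p z' = u - base e p z := by linear_combination h
      simp only [this, and_self, card_dotProduct_eq hz]
    · rw [filter_false_of_mem, card_empty, mul_zero]
      rintro y - ⟨h1, h2⟩
      exact h (by linear_combination h1 - h2)
  rw [he.pairCount_eq_sum, sq, mul_assoc, mul_sum]
  simp only [key]
  rw [← sum_filter, sum_const, hb, card_row, smul_eq_mul]
  ring

/-- Neither equation involves `y`, so a base point contributes all `y` or none, and by injectivity
at most one base point contributes. -/
theorem pairCount_of_dir_eq_zero {z z' : Col F ℓ} (hz : dir z = 0) (hz' : dir z' = 0)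
    (hinj : Function.Injective fun p => (base e p z, base e p z')) (u v : F) :
    pairCount e z z' u v = if (u, v) ∈ univ.image (fun p => (base e p z, base e p z')) then
      Fintype.card (Vec F ℓ) else 0 := by
  rw [he.pairCount_eq_sum]
  simp only [hz, hz', zero_dotProduct, add_zero, filter_const, apply_ite card, card_univ,
    card_empty]
  split_ifs with h
  · obtain ⟨p, -, hp⟩ := mem_image.1 h
    rw [sum_eq_single p]
    · rw [if_pos (Prod.ext_iff.1 hp)]
    · intro q _ hq
      exact if_neg fun hc => hq (hinj ((Prod.ext hc.1 hc.2 : (_, _) = (u, v)).trans hp.symm))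
    · simp
  · exact sum_eq_zero fun p _ => if_neg fun hc =>
      h (mem_image.2 ⟨p, mem_univ _, Prod.ext hc.1 hc.2⟩)

end IsDoubling

theorem IsLineSystem.ne_zero {Γ : Set (Vec F ℓ)} (hΓ : IsLineSystem Γ) {γ : Vec F ℓ}
    (h : γ ∈ Γ) : γ ≠ 0 := by
  rintro rfl
  simpa using hΓ.mapsTo h

theorem IsLineSystem.ne_smul {Γ : Set (Vec F ℓ)} (hΓ : IsLineSystem Γ) {γ γ' : Vec F ℓ}
    (h : γ ∈ Γ) (h' : γ' ∈ Γ) (hne : γ ≠ γ') (c : F) : γ' ≠ c • γ := by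
  rintro rfl
  have hc : c ≠ 0 := by
    rintro rfl
    exact hΓ.ne_zero h' (zero_smul _ _)
  refine hne (hΓ.injOn h h' ?_)
  exact (Submodule.span_singleton_smul_eq (IsUnit.mk0 c hc) γ).symm

namespace IsDoubling

variable {e : Row F ℓ → Col F ℓ → F} (he : IsDoubling e) {Γ : Set (Vec F ℓ)}
  (hΓ : IsLineSystem Γ) {Ξ : Set F} (hΞ : (0 : F) ∉ Ξ)
include he hΓ hΞ

theorem card_level {z : Col F ℓ} (hz : z ∈ colSet Γ Ξ) (u : F) :
    Fintype.card F * #{i | e i z = u} = Fintype.card (Row F ℓ) := by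
  rcases hz with rfl | ⟨a, γ, hγ, rfl⟩ | ⟨a, γ, hγ, rfl⟩ | ⟨δ, hδ, rfl⟩
  · exact he.card_level_of_dir_eq_zero rfl he.star u
  · exact he.card_level_of_dir_ne_zero (z := .lin a γ) (hΓ.ne_zero hγ) u
  · exact he.card_level_of_dir_ne_zero (z := .quad a γ) (hΓ.ne_zero hγ) u
  · exact he.card_level_of_dir_eq_zero rfl (he.extra δ (ne_of_mem_of_not_mem hδ hΞ)) u

theorem balanced_of_dir_eq_zero {z : Col F ℓ} (hz : z ∈ colSet Γ Ξ) (h0 : dir z = 0) :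
    Balanced fun p => base e p z := by
  rcases hz with rfl | ⟨a, γ, hγ, rfl⟩ | ⟨a, γ, hγ, rfl⟩ | ⟨δ, hδ, rfl⟩
  · exact he.star
  · exact (hΓ.ne_zero hγ h0).elim
  · exact (hΓ.ne_zero hγ h0).elim
  · exact he.extra δ (ne_of_mem_of_not_mem hδ hΞ)

theorem pairCount_eq {z z' : Col F ℓ} (hz : z ∈ colSet Γ Ξ) (hz' : z' ∈ colSet Γ Ξ)
    (hne : z ≠ z') (h0 : ¬ (dir z = 0 ∧ dir z' = 0)) (u v : F) :
    Fintype.card F ^ 2 * pairCount e z z' u v = Fintype.card (Row F ℓ) := by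
  by_cases h : dir z = 0
  · exact he.pairCount_of_dir_eq_zero_left h (fun h' => h0 ⟨h, h'⟩)
      (he.balanced_of_dir_eq_zero hΓ hΞ hz h) u v
  by_cases h' : dir z' = 0
  · rw [pairCount_comm]
    exact he.pairCount_of_dir_eq_zero_left h' h (he.balanced_of_dir_eq_zero hΓ hΞ hz' h') v u
  have mem : ∀ {z : Col F ℓ}, z ∈ colSet Γ Ξ → dir z ≠ 0 → dir z ∈ Γ := by
    rintro _ (rfl | ⟨a, γ, hγ, rfl⟩ | ⟨a, γ, hγ, rfl⟩ | ⟨δ, hδ, rfl⟩) h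
    exacts [(h rfl).elim, hγ, hγ, (h rfl).elim]
  by_cases hd : dir z = dir z'
  · refine he.pairCount_of_dir_eq h hd.symm ?_ u v
    rcases z with _ | ⟨a, γ⟩ | ⟨a, γ⟩ | _
    · exact (h rfl).elim
    · rcases z' with _ | ⟨a', γ'⟩ | ⟨a', γ'⟩ | _
      · exact (h' rfl).elim
      · obtain rfl : γ = γ' := hd
        exact he.lin_lin a a' γ fun h => hne (by rw [h])
      · obtain rfl : γ = γ' := hd
        exact he.lin_quad a a' γ
      · exact (h' rfl).elim
    · rcases z' with _ | ⟨a', γ'⟩ | ⟨a', γ'⟩ | _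
      · exact (h' rfl).elim
      · obtain rfl : γ = γ' := hd
        simpa using (he.lin_quad a' a γ).neg
      · obtain rfl : γ = γ' := hd
        exact he.quad_quad a a' γ fun h => hne (by rw [h])
      · exact (h' rfl).elim
    · exact (h rfl).elim
  · exact he.pairCount_of_independent h (hΓ.ne_smul (mem hz h) (mem hz' h') hd) u v

theorem injective_base {z z' : Col F ℓ} (hz : z ∈ colSet Γ Ξ) (hz' : z' ∈ colSet Γ Ξ)
    (hne : z ≠ z') (h : dir z = 0) (h' : dir z' = 0) :
    Function.Injective fun p => (base e p z, base e p z') := by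
  rcases hz with rfl | ⟨a, γ, hγ, rfl⟩ | ⟨a, γ, hγ, rfl⟩ | ⟨δ, hδ, rfl⟩
  · rcases hz' with rfl | ⟨a, γ, hγ, rfl⟩ | ⟨a, γ, hγ, rfl⟩ | ⟨δ, hδ, rfl⟩
    · exact (hne rfl).elim
    · exact (hΓ.ne_zero hγ h').elim
    · exact (hΓ.ne_zero hγ h').elim
    · exact he.star_extra δ (ne_of_mem_of_not_mem hδ hΞ)
  · exact (hΓ.ne_zero hγ h).elim
  · exact (hΓ.ne_zero hγ h).elim
  · rcases hz' with rfl | ⟨a, γ, hγ, rfl⟩ | ⟨a, γ, hγ, rfl⟩ | ⟨δ', hδ', rfl⟩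
    · exact Prod.swap_injective.comp (he.star_extra δ (ne_of_mem_of_not_mem hδ hΞ))
    · exact (hΓ.ne_zero hγ h').elim
    · exact (hΓ.ne_zero hγ h').elim
    · exact he.extra_extra δ (ne_of_mem_of_not_mem hδ hΞ) δ' (ne_of_mem_of_not_mem hδ' hΞ)
        fun h => hne (by rw [h])

theorem exists_pairCount_eq_ite {z z' : Col F ℓ} (hz : z ∈ colSet Γ Ξ) (hz' : z' ∈ colSet Γ Ξ)
    (hne : z ≠ z') (h : dir z = 0) (h' : dir z' = 0) :
    ∃ T : Finset (F × F), #T = 2 * Fintype.card F ∧ ∀ u v, pairCount e z z' u v =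
      if (u, v) ∈ T then Fintype.card (Vec F ℓ) else 0 := by
  have hinj := he.injective_base hΓ hΞ hz hz' hne h h'
  refine ⟨_, ?_, he.pairCount_of_dir_eq_zero h h' hinj⟩
  rw [card_image_of_injective _ hinj, card_univ, Fintype.card_sum, two_mul]

end IsDoubling

end

/-! ### Arrays whose pairs of columns are uniform except for a few special columns -/

theorem baseCols_eq {s ℓ : ℕ} (hs : 2 < s) : baseCols s ℓ = 2 * (∑ k ∈ range ℓ, s ^ k) - 1 := by
  rw [baseCols, Nat.geomSum_eq hs.le]

theorem two_lt_baseCols {s ℓ : ℕ} (hs : 2 < s) (hℓ : 2 ≤ ℓ) : 2 < baseCols s ℓ := by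
  have : ∑ k ∈ range 2, s ^ k ≤ ∑ k ∈ range ℓ, s ^ k :=
    sum_le_sum_of_subset (range_mono hℓ)
  simp only [sum_range_succ, range_zero, sum_empty, pow_zero, pow_one] at this
  rw [baseCols_eq hs]
  lia

/-- The indices of the columns that do not depend on `y`: the first and the last `κ`. -/
def specialCols (s ℓ κ : ℕ) : Finset (Fin (baseCols s ℓ + κ)) :=
  {j | j.val = 0 ∨ baseCols s ℓ ≤ j.val}

theorem card_extraCols (b κ : ℕ) : #{j : Fin (b + κ) | b ≤ j.val} = κ := by
  have : ({j : Fin (b + κ) | b ≤ j.val} : Finset _) = univ.map (Fin.natAddEmb b) := by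
    ext j
    simp only [mem_filter, mem_univ, true_and, mem_map, Fin.natAddEmb_apply]
    constructor
    · intro h
      exact ⟨⟨j - b, by lia⟩, by ext; simp; lia⟩
    · rintro ⟨a, rfl⟩
      simp
  rw [this, card_map, card_univ, Fintype.card_fin]

theorem card_specialCols {s ℓ : ℕ} (κ : ℕ) (hs : 2 < s) (hℓ : 2 ≤ ℓ) :
    #(specialCols s ℓ κ) = κ + 1 := by
  have hb := two_lt_baseCols hs hℓ
  have h : specialCols s ℓ κ =
      insert ⟨0, by lia⟩ ({j : Fin (baseCols s ℓ + κ) | baseCols s ℓ ≤ j.val} : Finset _) := by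
    ext j
    simp [specialCols, Fin.ext_iff]
  rw [h, card_insert_of_notMem (by simp; lia), card_extraCols]

theorem count_two {R C S : Type*} [Fintype R] [DecidableEq S] (A : Matrix R C S) (x : Fin 2 → S)
    (j : Fin 2 → C) : count A x j = #{i | A i (j 0) = x 0 ∧ A i (j 1) = x 1} := by
  rw [count]
  congr 1
  ext i
  simp [Fin.forall_fin_two]

theorem count_one {R C S : Type*} [Fintype R] [DecidableEq S] (A : Matrix R C S) (x : Fin 1 → S)
    (j : Fin 1 → C) : count A x j = #{i | A i (j 0) = x 0} := by
  rw [count]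
  congr 1
  ext i
  simp

/-- Increasing pairs correspond to two-element subsets. -/
theorem card_incTuple_two {C : Type*} [LinearOrder C] [Fintype C] (B : Finset C) :
    #{j : IncTuple 2 C | j.1 0 ∈ B ∧ j.1 1 ∈ B} = (#B).choose 2 := by
  rw [← card_powersetCard]
  have lt : ∀ j : IncTuple 2 C, j.1 0 < j.1 1 := fun j => j.2 Fin.zero_lt_one
  refine card_bij (fun j _ => {j.1 0, j.1 1}) ?_ ?_ ?_
  · intro j hj
    simp only [mem_filter, mem_univ, true_and] at hj
    rw [mem_powersetCard]
    exact ⟨by simp [insert_subset_iff, hj], card_pair (lt j).ne⟩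
  · intro j _ j' _ h
    have h1 := lt j
    have h2 := lt j'
    have e0 : j.1 0 = j'.1 0 ∧ j.1 1 = j'.1 1 := by
      have a := h ▸ mem_insert_self (j.1 0) {j.1 1}
      have b := h ▸ mem_insert_of_mem (mem_singleton_self (j.1 1))
      have c := h.symm ▸ mem_insert_self (j'.1 0) {j'.1 1}
      simp only [mem_insert, mem_singleton] at a b c
      rcases a with a | a <;> rcases b with b | b
      · exact absurd (a.trans b.symm) h1.ne
      · exact ⟨a, b⟩
      · rw [a, b] at h1
        exact absurd h1 h2.not_gt
      · exact absurd (a.trans b.symm) h1.ne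
    refine Subtype.ext (funext fun i => ?_)
    fin_cases i
    exacts [e0.1, e0.2]
  · intro t ht
    rw [mem_powersetCard, card_eq_two] at ht
    obtain ⟨hsub, x, y, hne, rfl⟩ := ht
    wlog hlt : x < y generalizing x y
    · obtain ⟨j, hj, h⟩ := this y x hne.symm (by rwa [pair_comm]) (hne.lt_or_gt.resolve_left hlt)
      exact ⟨j, hj, h.trans (pair_comm _ _)⟩
    · refine ⟨⟨![x, y], ?_⟩, ?_, by simp⟩
      · intro a b hab
        fin_cases a <;> fin_cases b <;> simp_all
      · exact mem_filter.2 ⟨mem_univ _, by simpa [insert_subset_iff] using hsub⟩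

/-- All levels are equally frequent in each column, all pairs of levels in each pair of columns
not both special; in a pair of special columns, `2 s` pairs of levels occur equally often. -/
structure IsUniformOffSpecial (s ℓ κ : ℕ) (A : AKArray s ℓ κ) : Prop where
  level : ∀ j u, s * #{i | A i j = u} = 2 * s ^ ℓ
  pair : ∀ j j', j ≠ j' → ¬ (j ∈ specialCols s ℓ κ ∧ j' ∈ specialCols s ℓ κ) → ∀ u v,
    s ^ 2 * #{i | A i j = u ∧ A i j' = v} = 2 * s ^ ℓ
  special : ∀ j j', j ≠ j' → j ∈ specialCols s ℓ κ → j' ∈ specialCols s ℓ κ →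
    ∃ T : Finset (Fin s × Fin s), #T = 2 * s ∧ ∀ u v,
      #{i | A i j = u ∧ A i j' = v} = if (u, v) ∈ T then s ^ (ℓ - 1) else 0

namespace IsUniformOffSpecial

variable {s ℓ κ : ℕ} {A : AKArray s ℓ κ} (hA : IsUniformOffSpecial s ℓ κ A) (hs : 2 < s)
include hA hs

theorem isOA_one (hb : 0 < baseCols s ℓ) : IsOA 1 A := by
  refine ⟨by rw [Fintype.card_fin]; lia, fun x j => ?_⟩
  have h : (s : ℝ) * #{i | A i (j.1 0) = x 0} = 2 * (s : ℝ) ^ ℓ := mod_cast hA.level (j.1 0) (x 0)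
  have hs0 : (s : ℝ) ≠ 0 := by positivity
  rw [count_one, Fintype.card_fin, Fintype.card_fin, pow_one, eq_div_iff hs0, mul_comm, h]
  push_cast
  rfl

theorem count_eq {j j' : Fin (baseCols s ℓ + κ)} (hne : j ≠ j')
    (h : ¬ (j ∈ specialCols s ℓ κ ∧ j' ∈ specialCols s ℓ κ)) (u v : Fin s) :
    (#{i | A i j = u ∧ A i j' = v} : ℝ) =
      (Fintype.card (Fin (2 * s ^ ℓ)) : ℝ) / (Fintype.card (Fin s) : ℝ) ^ 2 := by
  have h : (s : ℝ) ^ 2 * #{i | A i j = u ∧ A i j' = v} = 2 * (s : ℝ) ^ ℓ := mod_cast hA.pair j j' hne h u v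
  have hs0 : (s : ℝ) ^ 2 ≠ 0 := by positivity
  rw [Fintype.card_fin, Fintype.card_fin, eq_div_iff hs0, mul_comm, h]
  push_cast
  rfl

theorem isOA_two_submatrix {C : Type*} [LinearOrder C] [Fintype C]
    {f : C → Fin (baseCols s ℓ + κ)} (hf : Function.Injective f) (hC : 2 ≤ Fintype.card C)
    (h : ∀ a b, f a ∈ specialCols s ℓ κ → f b ∈ specialCols s ℓ κ → a = b) :
    IsOA 2 (A.submatrix id f) := by
  refine ⟨hC, fun x j => ?_⟩
  have lt : j.1 0 < j.1 1 := j.2 Fin.zero_lt_one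
  rw [count_two]
  exact hA.count_eq hs (hf.ne lt.ne) (fun hh => lt.ne (h _ _ hh.1 hh.2)) (x 0) (x 1)

theorem isOA_first_cols (hℓ : 2 ≤ ℓ) :
    IsOA 2 (A.submatrix id (Fin.castAdd κ : Fin (baseCols s ℓ) → _)) := by
  have hb := two_lt_baseCols hs hℓ
  refine hA.isOA_two_submatrix hs (Fin.castAdd_injective _ _) (by rw [Fintype.card_fin]; lia) ?_
  intro a b ha hb
  simp only [specialCols, mem_filter, mem_univ, true_and, Fin.val_castAdd] at ha hb
  ext
  lia

theorem isOA_removed_cols (hℓ : 2 ≤ ℓ) (hκ : 1 ≤ κ) (D : Finset (Fin (baseCols s ℓ + κ)))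
    (hD : ∀ j ∈ D, baseCols s ℓ ≤ j.val) (hcard : #D = κ - 1) :
    IsOA 2 (A.submatrix id
      (Subtype.val : {j : Fin (baseCols s ℓ + κ) // j.val ≠ 0 ∧ j ∉ D} → _)) := by
  have hb := two_lt_baseCols hs hℓ
  refine hA.isOA_two_submatrix hs Subtype.val_injective ?_ ?_
  -- Columns `1` and `2` survive the removal, being neither first nor extra.
  · refine Fintype.one_lt_card_iff.2 ⟨⟨⟨1, by lia⟩, by simp, fun h => ?_⟩,
      ⟨⟨2, by lia⟩, by simp, fun h => ?_⟩, by simp⟩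
    · have := hD _ h
      simp only at this
      lia
    · have := hD _ h
      simp only at this
      lia
  · rintro ⟨a, ha0, haD⟩ ⟨b, hb0, hbD⟩ ha hb
    simp only [specialCols, mem_filter, mem_univ, true_and, ha0, hb0, false_or] at ha hb
    by_contra hne
    have hab : a ≠ b := fun h => hne (Subtype.ext h)
    -- Two surviving special columns, together with `D`, would be `κ + 1` extra columns.
    have hsub : insert a (insert b D) ⊆
        ({j : Fin (baseCols s ℓ + κ) | baseCols s ℓ ≤ j.val} : Finset _) := by
      simp only [insert_subset_iff, mem_filter, mem_univ, true_and, ha, hb]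
      exact fun j hj => by simpa using hD j hj
    have := card_le_card hsub
    rw [card_extraCols, card_insert_of_notMem (by simp [hab, haD]), card_insert_of_notMem hbD,
      hcard] at this
    lia

theorem deviation_eq_zero (x : Fin 2 → Fin s) (j : IncTuple 2 (Fin (baseCols s ℓ + κ)))
    (h : ¬ (j.1 0 ∈ specialCols s ℓ κ ∧ j.1 1 ∈ specialCols s ℓ κ)) : deviation A x j = 0 := by
  have lt : j.1 0 < j.1 1 := j.2 Fin.zero_lt_one
  rw [deviation, count_two, hA.count_eq hs lt.ne h, sub_self, abs_zero]

theorem exists_deviation_eq (hℓ : 2 ≤ ℓ) (j : IncTuple 2 (Fin (baseCols s ℓ + κ)))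
    (h0 : j.1 0 ∈ specialCols s ℓ κ) (h1 : j.1 1 ∈ specialCols s ℓ κ) :
    ∃ T : Finset (Fin s × Fin s), #T = 2 * s ∧ ∀ x : Fin 2 → Fin s, deviation A x j =
      if (x 0, x 1) ∈ T then ((s : ℝ) - 2) * s ^ (ℓ - 2) else 2 * s ^ (ℓ - 2) := by
  have lt : j.1 0 < j.1 1 := j.2 Fin.zero_lt_one
  obtain ⟨T, hT, h⟩ := hA.special _ _ lt.ne h0 h1
  refine ⟨T, hT, fun x => ?_⟩
  obtain ⟨m, rfl⟩ := Nat.exists_eq_add_of_le' hℓ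
  have hs0 : (s : ℝ) ≠ 0 := by positivity
  have hs2 : (0 : ℝ) ≤ (s : ℝ) - 2 := by
    rw [sub_nonneg]
    exact_mod_cast hs.le
  have hmean : (Fintype.card (Fin (2 * s ^ (m + 2))) : ℝ) / (Fintype.card (Fin s) : ℝ) ^ 2 =
      2 * s ^ m := by
    rw [Fintype.card_fin, Fintype.card_fin]
    push_cast
    field_simp
    ring
  rw [deviation, count_two, h, hmean, Nat.add_sub_cancel]
  split_ifs
  · rw [show m + 2 - 1 = m + 1 by lia, Nat.cast_pow,
      show (s : ℝ) ^ (m + 1) - 2 * s ^ m = (s - 2) * s ^ m by ring, abs_of_nonneg (by positivity)]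
  · rw [Nat.cast_zero, zero_sub, abs_neg, abs_of_nonneg (by positivity)]

theorem tolerance_eq (hℓ : 2 ≤ ℓ) (hκ : 1 ≤ κ) :
    tolerance 2 A = max 2 ((s : ℝ) - 2) * (s : ℝ) ^ (ℓ - 2) := by
  have hb := two_lt_baseCols hs hℓ
  have hpow : (0 : ℝ) ≤ (s : ℝ) ^ (ℓ - 2) := by positivity
  -- The first column and the first extra one; the latter exists because `1 ≤ κ`. This pair attains
  -- both deviations, since `0 < 2 * s < s * s`.
  let j : IncTuple 2 (Fin (baseCols s ℓ + κ)) :=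
    ⟨![⟨0, by lia⟩, ⟨baseCols s ℓ, by lia⟩], by
      intro a b hab
      fin_cases a <;> fin_cases b <;> simp_all
      lia⟩
  obtain ⟨T, hT, h⟩ := hA.exists_deviation_eq hs hℓ j (by simp [j, specialCols])
    (by simp [j, specialCols])
  obtain ⟨⟨u, v⟩, huv⟩ : T.Nonempty := by
    rw [← card_pos]
    lia
  obtain ⟨⟨u', v'⟩, huv'⟩ : ∃ q, q ∉ T := by
    by_contra! hall
    have : #T = s * s := by
      rw [eq_univ_iff_forall.2 hall, card_univ, Fintype.card_prod, Fintype.card_fin]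
    nlinarith
  have bdd : BddAbove (Set.range fun q : (Fin 2 → Fin s) × IncTuple 2 (Fin (baseCols s ℓ + κ)) =>
      deviation A q.1 q.2) := (Set.finite_range _).bddAbove
  have le1 := le_ciSup bdd (![u, v], j)
  have le2 := le_ciSup bdd (![u', v'], j)
  simp only [h, Matrix.cons_val_zero, Matrix.cons_val_one, huv, huv', if_true, if_false]
    at le1 le2
  have : Nonempty ((Fin 2 → Fin s) × IncTuple 2 (Fin (baseCols s ℓ + κ))) := ⟨(![u, v], j)⟩
  refine le_antisymm (ciSup_le fun q => ?_) ?_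
  · by_cases hq : q.2.1 0 ∈ specialCols s ℓ κ ∧ q.2.1 1 ∈ specialCols s ℓ κ
    · obtain ⟨T, -, hT⟩ := hA.exists_deviation_eq hs hℓ q.2 hq.1 hq.2
      rw [hT]
      split_ifs
      · exact mul_le_mul_of_nonneg_right (le_max_right _ _) hpow
      · exact mul_le_mul_of_nonneg_right (le_max_left _ _) hpow
    · rw [hA.deviation_eq_zero hs _ _ hq]
      positivity
  · rw [max_mul_of_nonneg _ _ hpow]
    exact max_le le2 le1

theorem sum_deviation_rpow (hℓ : 2 ≤ ℓ) (p : ℝ) (j : IncTuple 2 (Fin (baseCols s ℓ + κ)))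
    (h0 : j.1 0 ∈ specialCols s ℓ κ) (h1 : j.1 1 ∈ specialCols s ℓ κ) :
    ∑ x : Fin 2 → Fin s, deviation A x j ^ p =
      (2 * s * ((s : ℝ) - 2)) * (((s : ℝ) - 2) ^ (p - 1) + (2 : ℝ) ^ (p - 1)) *
        (s : ℝ) ^ (((ℓ : ℝ) - 2) * p) := by
  obtain ⟨T, hT, h⟩ := hA.exists_deviation_eq hs hℓ j h0 h1
  have hs2 : (0 : ℝ) < (s : ℝ) - 2 := by
    rw [sub_pos]
    exact_mod_cast hs
  have hpow : (0 : ℝ) ≤ (s : ℝ) ^ (ℓ - 2) := by positivity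
  have hsum : ∑ x : Fin 2 → Fin s, deviation A x j ^ p = ∑ q : Fin s × Fin s,
      if q ∈ T then (((s : ℝ) - 2) * s ^ (ℓ - 2)) ^ p else (2 * (s : ℝ) ^ (ℓ - 2)) ^ p := by
    refine Fintype.sum_equiv (finTwoArrowEquiv _) _ _ fun x => ?_
    rw [h, apply_ite (· ^ p)]
    rfl
  -- The sum is a common power of `s` times `2s(s-2)^p + s(s-2)2^p`, from which `2s(s-2)` is
  -- factored out.
  have hcompl : (#{q | q ∉ T} : ℝ) = s * (s - 2) := by
    have h1 := card_compl_add_card T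
    rw [Fintype.card_prod, Fintype.card_fin, hT] at h1
    have h2 : ({q | q ∉ T} : Finset (Fin s × Fin s)) = Tᶜ := by
      ext
      simp
    rw [h2]
    have h3 : (#Tᶜ : ℝ) + 2 * s = s * s := mod_cast h1
    linarith
  rw [hsum, sum_ite, sum_const, sum_const, filter_mem_eq_inter, univ_inter, hT, nsmul_eq_mul,
    nsmul_eq_mul, hcompl, Real.mul_rpow hs2.le hpow, Real.mul_rpow zero_le_two hpow,
    ← Real.rpow_natCast, ← Real.rpow_mul (Nat.cast_nonneg _), Nat.cast_sub hℓ,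
    Real.rpow_sub_one hs2.ne', Real.rpow_sub_one two_ne_zero]
  push_cast
  field_simp

theorem unbalance_eq (hℓ : 2 ≤ ℓ) (p : ℝ) (hp : 1 ≤ p) :
    unbalance p 2 A = ((κ + 1).choose 2 : ℝ) * (2 * s * ((s : ℝ) - 2)) *
      (((s : ℝ) - 2) ^ (p - 1) + (2 : ℝ) ^ (p - 1)) * (s : ℝ) ^ (((ℓ : ℝ) - 2) * p) := by
  have key : ∀ j : IncTuple 2 (Fin (baseCols s ℓ + κ)), ∑ x : Fin 2 → Fin s, deviation A x j ^ p =
      if j.1 0 ∈ specialCols s ℓ κ ∧ j.1 1 ∈ specialCols s ℓ κ then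
        (2 * s * ((s : ℝ) - 2)) * (((s : ℝ) - 2) ^ (p - 1) + (2 : ℝ) ^ (p - 1)) *
          (s : ℝ) ^ (((ℓ : ℝ) - 2) * p) else 0 := by
    intro j
    split_ifs with h
    · exact hA.sum_deviation_rpow hs hℓ p j h.1 h.2
    · refine sum_eq_zero fun x _ => ?_
      rw [hA.deviation_eq_zero hs _ _ h, Real.zero_rpow (by linarith)]
  rw [unbalance, sum_comm, sum_congr rfl fun j _ => key j, ← sum_filter, sum_const,
    card_incTuple_two, card_specialCols κ hs hℓ, nsmul_eq_mul]
  ring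

theorem akProperties (hℓ : 2 ≤ ℓ) (hκ : 1 ≤ κ) : AKProperties s ℓ κ A where
  strength_one := hA.isOA_one hs (by have := two_lt_baseCols hs hℓ; lia)
  first_cols := hA.isOA_first_cols hs hℓ
  removed_cols := hA.isOA_removed_cols hs hℓ hκ
  tolerance_eq := hA.tolerance_eq hs hℓ hκ
  unbalance_eq := hA.unbalance_eq hs hℓ

end IsUniformOffSpecial

/-! ### Instances of the construction -/

theorem dir_ne_zero_of_notMem_specialCols {F : Type} [Field F] [Fintype F] {s ℓ κ : ℕ}
    (hb : 0 < baseCols s ℓ) {Γ : Set (Vec F ℓ)} (hΓ : IsLineSystem Γ) {Ξ : Set F}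
    (hΞ : Ξ.ncard = κ) {c : Fin (baseCols s ℓ + κ) → Col F ℓ}
    (hc : Set.BijOn c Set.univ (colSet Γ Ξ)) (hstar : ∀ j, j.val = 0 → c j = .star)
    (hextra : ∀ j, baseCols s ℓ ≤ j.val → ∃ δ ∈ Ξ, c j = .extra δ)
    {j : Fin (baseCols s ℓ + κ)} (hj : j ∉ specialCols s ℓ κ) : dir (c j) ≠ 0 := by
  classical
  have hinj : Function.Injective c := Set.injOn_univ.1 hc.injOn
  simp only [specialCols, mem_filter, mem_univ, true_and, not_or] at hj
  have hcj : c j ∈ colSet Γ Ξ := hc.mapsTo (Set.mem_univ j)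
  rcases hcj with h | ⟨a, γ, hγ, h⟩ | ⟨a, γ, hγ, h⟩ | ⟨δ, hδ, h⟩
  · exact (hj.1 (congrArg Fin.val
      (hinj (h.trans (hstar ⟨0, by lia⟩ rfl).symm)))).elim
  · rw [h]
    exact hΓ.ne_zero hγ
  · rw [h]
    exact hΓ.ne_zero hγ
  · exfalso
    -- The last `κ` positions already exhaust the `κ` extra columns, so by injectivity none can sit
    -- elsewhere.
    have hsub : ({j : Fin (baseCols s ℓ + κ) | baseCols s ℓ ≤ j.val} : Finset _).image c ⊆
        Ξ.toFinite.toFinset.image .extra := by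
      intro z hz
      obtain ⟨k, hk, rfl⟩ := mem_image.1 hz
      obtain ⟨δ, hδ, h⟩ := hextra k (by simpa using hk)
      exact mem_image.2 ⟨δ, by simpa using hδ, h.symm⟩
    have hle := card_image_le (s := Ξ.toFinite.toFinset) (f := (Col.extra : F → Col F ℓ))
    rw [← Set.ncard_eq_toFinset_card Ξ Ξ.toFinite, hΞ] at hle
    have heq := eq_of_subset_of_card_le hsub
      (by rw [card_image_of_injective _ hinj, card_extraCols]; exact hle)
    have : c j ∈ Ξ.toFinite.toFinset.image .extra :=
      mem_image.2 ⟨δ, by simpa using hδ, h.symm⟩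
    rw [← heq] at this
    obtain ⟨k, hk, hkj⟩ := mem_image.1 this
    rw [hinj hkj] at hk
    exact hj.2 (by simpa using hk)

theorem dir_eq_zero_iff {F : Type} [Field F] [Fintype F] {s ℓ κ : ℕ}
    (hb : 0 < baseCols s ℓ) {Γ : Set (Vec F ℓ)} (hΓ : IsLineSystem Γ) {Ξ : Set F}
    (hΞ : Ξ.ncard = κ) {c : Fin (baseCols s ℓ + κ) → Col F ℓ}
    (hc : Set.BijOn c Set.univ (colSet Γ Ξ)) (hstar : ∀ j, j.val = 0 → c j = .star)
    (hextra : ∀ j, baseCols s ℓ ≤ j.val → ∃ δ ∈ Ξ, c j = .extra δ)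
    (j : Fin (baseCols s ℓ + κ)) : dir (c j) = 0 ↔ j ∈ specialCols s ℓ κ := by
  refine ⟨fun h => by_contra fun hj =>
    dir_ne_zero_of_notMem_specialCols hb hΓ hΞ hc hstar hextra hj h, fun h => ?_⟩
  simp only [specialCols, mem_filter, mem_univ, true_and] at h
  rcases h with h | h
  · rw [hstar j h]
    rfl
  · obtain ⟨δ, -, hδ⟩ := hextra j h
    rw [hδ]
    rfl

theorem charP_two_of_even_card {F : Type} [Field F] [Fintype F] (h : Even (Fintype.card F)) :
    CharP F 2 :=
  ringChar.of_eq (FiniteField.even_card_iff_char_two.2 (Nat.even_iff.1 h))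

theorem card_eq_two_pow_log {F : Type} [Field F] [Fintype F] [CharP F 2] :
    Fintype.card F = 2 ^ Nat.log 2 (Fintype.card F) := by
  obtain ⟨n, -, hn⟩ := FiniteField.card F 2
  rw [hn, Nat.log_pow one_lt_two]

theorem IsDoubledAK.isUniformOffSpecial {s ℓ κ : ℕ} (hs : 2 < s) (hℓ : 2 ≤ ℓ)
    {A : AKArray s ℓ κ} (hA : IsDoubledAK s ℓ κ A) : IsUniformOffSpecial s ℓ κ A := by
  classical
  obtain ⟨F, _, σ, r, Γ, Ξ, c, hΓ, h0, hΞ, hc, hstar, hextra, hform⟩ := hA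
  let _ : Fintype F := Fintype.ofEquiv _ σ
  have hF : Fintype.card F = s := by
    rw [← Fintype.card_congr σ, Fintype.card_fin]
  obtain ⟨e, he, hAe⟩ : ∃ e : Row F ℓ → Col F ℓ → F, IsDoubling e ∧
      ∀ i j, σ (A i j) = e (r i) (c j) := by
    rcases hform with ⟨hodd, ω, β₀, hω, h⟩ | ⟨heven, ζ, hζ, h⟩
    · refine ⟨_, oddEntry_isDoubling (fun h2 => ?_) hω β₀, h⟩
      have := FiniteField.even_card_iff_char_two.1 h2
      rw [hF] at this
      exact Nat.not_even_iff_odd.2 hodd (Nat.even_iff.2 this)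
    · have : CharP F 2 := charP_two_of_even_card (hF ▸ heven)
      have hcard := card_eq_two_pow_log (F := F)
      rw [hF] at hcard
      exact ⟨_, evenEntry_isDoubling (sq_add_self_ne (hF.trans hcard) hζ), h⟩
  have hb := two_lt_baseCols hs hℓ
  have hdir := dir_eq_zero_iff (pos_of_gt hb) hΓ hΞ hc hstar hextra
  have hmem : ∀ j, c j ∈ colSet Γ Ξ := fun j => hc.mapsTo (Set.mem_univ j)
  have hinj : Function.Injective c := Set.injOn_univ.1 hc.injOn
  have hV : Fintype.card (Vec F ℓ) = s ^ (ℓ - 1) := by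
    rw [Fintype.card_fun, Fintype.card_fin, hF]
  have hR : Fintype.card (Row F ℓ) = 2 * s ^ ℓ := by
    rw [← Fintype.card_congr r, Fintype.card_fin]
  have hlevel : ∀ j u, #{i | A i j = u} = #{i | e i (c j) = σ u} := fun j u =>
    card_bijective r r.bijective fun i => by simp [← hAe]
  have hpair : ∀ j j' u v,
      #{i | A i j = u ∧ A i j' = v} = pairCount e (c j) (c j') (σ u) (σ v) := fun j j' u v =>
    card_bijective r r.bijective fun i => by simp [← hAe]
  refine ⟨fun j u => ?_, fun j j' hne h u v => ?_, fun j j' hne hj hj' => ?_⟩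
  · rw [hlevel, ← hR, ← he.card_level hΓ h0 (hmem j) (σ u), hF]
  · rw [← hdir, ← hdir] at h
    rw [hpair, ← hR, ← he.pairCount_eq hΓ h0 (hmem j) (hmem j') (hinj.ne hne) h (σ u) (σ v), hF]
  · rw [← hdir] at hj hj'
    obtain ⟨T, hT, h⟩ := he.exists_pairCount_eq_ite hΓ h0 (hmem j) (hmem j') (hinj.ne hne) hj hj'
    refine ⟨T.map (σ.symm.prodCongr σ.symm).toEmbedding, ?_, fun u v => ?_⟩
    · rw [card_map, hT, hF]
    · rw [hpair, h, hV]
      simp [mem_map_equiv]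

/-! ### Existence -/

theorem exists_isLineSystem (F : Type) [Field F] (ℓ : ℕ) :
    ∃ Γ : Set (Vec F ℓ), IsLineSystem Γ := by
  have hsurj : Set.SurjOn (fun v : Vec F ℓ => Submodule.span F {v}) Set.univ
      {W : Submodule F (Vec F ℓ) | Module.finrank F W = 1} := by
    intro W hW
    obtain ⟨v, -, hv⟩ := finrank_eq_one_iff'.1 hW
    refine ⟨v, Set.mem_univ _, le_antisymm ?_ fun w hw => ?_⟩
    · simp
    · obtain ⟨a, ha⟩ := hv ⟨w, hw⟩
      exact Submodule.mem_span_singleton.2 ⟨a, congrArg Subtype.val ha⟩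
  obtain ⟨Γ, -, h⟩ := hsurj.exists_bijOn_subset
  exact ⟨Γ, h⟩

/-- `Γ` is in bijection with the points of the projective space of `F ^ (ℓ - 1)`. -/
theorem IsLineSystem.ncard_mul {F : Type} [Field F] [Finite F] {ℓ : ℕ} {Γ : Set (Vec F ℓ)}
    (hΓ : IsLineSystem Γ) : Nat.card F ^ (ℓ - 1) = Γ.ncard * (Nat.card F - 1) + 1 := by
  have h := Projectivization.card' F (Vec F ℓ)
  rw [Nat.card_congr (Projectivization.equivSubmodule F (Vec F ℓ))] at h
  have h2 : Nat.card {H : Submodule F (Vec F ℓ) // Module.finrank F H = 1} = Γ.ncard := by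
    rw [← Nat.card_coe_set_eq Γ]
    exact Nat.card_congr hΓ.equiv.symm
  rw [h2, Nat.card_fun, Nat.card_fin] at h
  exact h

/-- Matches the closed formula with one column `∗` and two families indexed by `F × Γ`. -/
theorem IsLineSystem.baseCols_eq {F : Type} [Field F] [Finite F] {ℓ : ℕ} (hℓ : 1 ≤ ℓ)
    {Γ : Set (Vec F ℓ)} (hΓ : IsLineSystem Γ) :
    baseCols (Nat.card F) ℓ = 2 * (Nat.card F * Γ.ncard) + 1 := by
  have h := hΓ.ncard_mul
  have h1 : 0 < Nat.card F - 1 := Nat.sub_pos_of_lt Finite.one_lt_card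
  obtain ⟨m, rfl⟩ := Nat.exists_eq_add_of_le' hℓ
  rw [Nat.add_sub_cancel] at h
  have h2 : Nat.card F ^ (m + 1) - 1 = (Nat.card F * Γ.ncard + 1) * (Nat.card F - 1) := by
    rw [pow_succ', h]
    obtain ⟨q, hq⟩ := Nat.exists_eq_add_of_lt h1
    have : Nat.card F = q + 2 := by lia
    rw [this]
    refine Nat.sub_eq_of_eq_add ?_
    rw [show q + 2 - 1 = q + 1 by lia]
    ring
  rw [baseCols, h2, Nat.mul_div_cancel _ h1]
  lia

/-- A parametrization of the columns other than the extra ones. -/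
def baseCol {F : Type} {ℓ : ℕ} (Γ : Set (Vec F ℓ)) : Option ((F × Γ) ⊕ (F × Γ)) → Col F ℓ
  | none => .star
  | some (.inl (a, γ)) => .lin a γ
  | some (.inr (β, γ)) => .quad β γ

theorem baseCol_injective {F : Type} {ℓ : ℕ} (Γ : Set (Vec F ℓ)) :
    Function.Injective (baseCol Γ) := by
  rintro (_ | ⟨a, γ, _⟩ | ⟨a, γ, _⟩) (_ | ⟨a, γ, _⟩ | ⟨a, γ, _⟩) h <;> simp_all [baseCol]

theorem exists_column_numbering {F : Type} [Field F] [Finite F] {ℓ κ : ℕ} (hℓ : 1 ≤ ℓ)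
    {Γ : Set (Vec F ℓ)} (hΓ : IsLineSystem Γ) {Ξ : Set F} (hΞ : Ξ.ncard = κ) :
    ∃ c : Fin (baseCols (Nat.card F) ℓ + κ) → Col F ℓ, Set.BijOn c Set.univ (colSet Γ Ξ) ∧
      (∀ j, j.val = 0 → c j = .star) ∧
      (∀ j, baseCols (Nat.card F) ℓ ≤ j.val → ∃ δ ∈ Ξ, c j = .extra δ) := by
  have hb := hΓ.baseCols_eq hℓ
  have hcard : Nat.card (Option ((F × Γ) ⊕ (F × Γ))) = baseCols (Nat.card F) ℓ := by
    rw [Finite.card_option, Nat.card_sum, Nat.card_prod, hb, Nat.card_coe_set_eq, two_mul]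
  let φ₀ := (Finite.equivFinOfCardEq hcard).symm
  have hpos : 0 < baseCols (Nat.card F) ℓ := by lia
  classical
  -- The swap moves `∗` to position `0` of an arbitrary numbering.
  let φ := φ₀.trans (Equiv.swap (φ₀ ⟨0, hpos⟩) none)
  have hφ : φ ⟨0, hpos⟩ = none := by simp [φ]
  let ψ : Fin κ ≃ Ξ := (Finite.equivFinOfCardEq ((Nat.card_coe_set_eq Ξ).trans hΞ)).symm
  refine ⟨Fin.append (fun i => baseCol Γ (φ i)) (fun i => .extra (ψ i).1),
    ⟨?_, ?_, ?_⟩, ?_, ?_⟩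
  · intro j _
    induction j using Fin.addCases with
    | left i =>
      rw [Fin.append_left]
      rcases φ i with _ | ⟨a, γ⟩ | ⟨a, γ⟩
      · exact .inl rfl
      · exact .inr (.inl ⟨a, γ, γ.2, rfl⟩)
      · exact .inr (.inr (.inl ⟨a, γ, γ.2, rfl⟩))
    | right i =>
      rw [Fin.append_right]
      exact .inr (.inr (.inr ⟨_, (ψ i).2, rfl⟩))
  · rw [Set.injOn_univ, Fin.append_injective_iff]
    refine ⟨(baseCol_injective Γ).comp φ.injective, fun i k h => ?_, fun i k h => ?_⟩
    · exact ψ.injective (Subtype.ext (by simpa using h))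
    · generalize φ i = o at h
      rcases o with _ | ⟨a, γ⟩ | ⟨a, γ⟩ <;> simp [baseCol] at h
  · have hsurj : ∀ o, ∃ j, baseCol Γ o = Fin.append (fun i => baseCol Γ (φ i))
        (fun i => Col.extra (ψ i).1) j := fun o =>
      ⟨Fin.castAdd κ (φ.symm o), by rw [Fin.append_left, φ.apply_symm_apply]⟩
    rintro z (rfl | ⟨a, γ, hγ, rfl⟩ | ⟨a, γ, hγ, rfl⟩ | ⟨δ, hδ, rfl⟩)
    · obtain ⟨j, hj⟩ := hsurj none
      exact ⟨j, trivial, hj.symm⟩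
    · obtain ⟨j, hj⟩ := hsurj (some (.inl (a, ⟨γ, hγ⟩)))
      exact ⟨j, trivial, hj.symm⟩
    · obtain ⟨j, hj⟩ := hsurj (some (.inr (a, ⟨γ, hγ⟩)))
      exact ⟨j, trivial, hj.symm⟩
    · exact ⟨Fin.natAdd _ (ψ.symm ⟨δ, hδ⟩), trivial, by
        rw [Fin.append_right, ψ.apply_symm_apply]⟩
  · intro j hj
    have : j = Fin.castAdd κ ⟨0, hpos⟩ := Fin.ext hj
    rw [this, Fin.append_left, hφ]
    rfl
  · intro j hj
    induction j using Fin.addCases with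
    | left i => exact absurd hj (by simp)
    | right i => exact ⟨_, (ψ i).2, Fin.append_right _ _ _⟩

/-- The trace to the prime field is surjective and equals the sum of Frobenius conjugates. -/
theorem exists_trace_eq_one (F : Type) [Field F] [Fintype F] [CharP F 2] :
    ∃ ζ : F, ∑ i ∈ range (Nat.log 2 (Fintype.card F)), ζ ^ 2 ^ i = 1 := by
  let _ : Algebra (ZMod 2) F := ZMod.algebra F 2
  obtain ⟨ζ, hζ⟩ := Algebra.trace_surjective (ZMod 2) F 1
  refine ⟨ζ, ?_⟩
  have h := FiniteField.algebraMap_trace_eq_sum_pow (ZMod 2) F ζ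
  rw [hζ, map_one, Nat.card_zmod] at h
  rw [h, Module.card_eq_pow_finrank (K := ZMod 2) (V := F), ZMod.card, Nat.log_pow one_lt_two]

theorem exists_isDoubledAK {s ℓ κ : ℕ} (hs : IsPrimePow s) (hκ : κ ≤ s - 1) (hℓ : 1 ≤ ℓ) :
    ∃ A : AKArray s ℓ κ, IsDoubledAK s ℓ κ A := by
  classical
  obtain ⟨p, k, hp, hk, rfl⟩ := hs
  have : Fact p.Prime := ⟨hp.nat_prime⟩
  let F := GaloisField p k
  let _ : Fintype F := Fintype.ofFinite F
  have hF : Nat.card F = p ^ k := GaloisField.card p k hk.ne'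
  generalize p ^ k = s at *
  subst hF
  let σ : Fin (Nat.card F) ≃ F := (Finite.equivFin F).symm
  have hR : Nat.card (Row F ℓ) = 2 * Nat.card F ^ ℓ := by
    rw [Nat.card_sum, Nat.card_prod, Nat.card_fun, Nat.card_fin, ← two_mul, ← pow_succ',
      Nat.sub_add_cancel hℓ]
  let r : Fin (2 * Nat.card F ^ ℓ) ≃ Row F ℓ := (Finite.equivFinOfCardEq hR).symm
  obtain ⟨Γ, hΓ⟩ := exists_isLineSystem F ℓ
  obtain ⟨Ξ, hΞ0, hΞ⟩ := exists_subset_card_eq (s := univ.erase (0 : F)) (n := κ)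
    (by rwa [card_erase_of_mem (mem_univ _), card_univ, ← Nat.card_eq_fintype_card])
  have h0 : (0 : F) ∉ (Ξ : Set F) := fun h => by simpa using hΞ0 h
  have hΞ' : (Ξ : Set F).ncard = κ := by rw [Set.ncard_coe_finset, hΞ]
  obtain ⟨c, hc, hstar, hextra⟩ := exists_column_numbering hℓ hΓ hΞ'
  by_cases hev : Even (Nat.card F)
  · have : CharP F 2 := charP_two_of_even_card (by rwa [← Nat.card_eq_fintype_card])
    obtain ⟨ζ, hζ⟩ := exists_trace_eq_one F
    rw [← Nat.card_eq_fintype_card] at hζ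
    exact ⟨fun i j => σ.symm (evenEntry ζ (r i) (c j)), F, inferInstance, σ, r, Γ, Ξ, c, hΓ, h0,
      hΞ', hc, hstar, hextra, .inr ⟨hev, ζ, hζ, fun i j => σ.apply_symm_apply _⟩⟩
  · obtain ⟨ω, hω⟩ := FiniteField.exists_nonsquare (F := F) fun h => hev (by
      rw [Nat.card_eq_fintype_card]
      exact Nat.even_iff.2 (FiniteField.even_card_iff_char_two.1 h))
    exact ⟨fun i j => σ.symm (oddEntry ω 0 (r i) (c j)), F, inferInstance, σ, r, Γ, Ξ, c, hΓ, h0,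
      hΞ', hc, hstar, hextra,
      .inl ⟨Nat.not_even_iff_odd.1 hev, ω, 0, hω, fun i j => σ.apply_symm_apply _⟩⟩

end AlmostOrthogonal

theorem mainTheorem2 (s ℓ κ : ℕ) (hs : IsPrimePow s) (hs2 : 2 < s) (hκ1 : 1 ≤ κ)
    (hκ : κ ≤ s - 1) (hℓ : 2 ≤ ℓ) :
    (∃ A : AlmostOrthogonal.AKArray s ℓ κ,
      AlmostOrthogonal.AKProperties s ℓ κ A ∧ AlmostOrthogonal.IsDoubledAK s ℓ κ A) ∧
    (∀ A : AlmostOrthogonal.AKArray s ℓ κ,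
      AlmostOrthogonal.IsDoubledAK s ℓ κ A → AlmostOrthogonal.AKProperties s ℓ κ A) := by
  have key : ∀ A : AlmostOrthogonal.AKArray s ℓ κ,
      AlmostOrthogonal.IsDoubledAK s ℓ κ A → AlmostOrthogonal.AKProperties s ℓ κ A :=
    fun A hA => (hA.isUniformOffSpecial hs2 hℓ).akProperties hs2 hℓ hκ1
  obtain ⟨A, hA⟩ := AlmostOrthogonal.exists_isDoubledAK hs hκ (one_le_two.trans hℓ)
  exact ⟨⟨A, key A hA, hA⟩, key⟩
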